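/- **Setting.** An LRS II spacetime is a 4-manifold $M$ covered by smooth adapted charts $(t,\chi,y,z)$ in which the metric is $$ds^2=-a(t,\chi)^2dt^2+b(t,\chi)^2d\chi^2+F(t,\chi)^2\big(dy^2+G(y,k)^2dz^2\big),\qquad a,b,F>0 \text{ smooth},$$ with $k\in\{-1,0,1\}$ fixed and $G(y,k)=\sinh y,\;y,\;\sin y$ for $k=-1,0,1$ (charts are restricted to $G>0$); coordinate changes preserve the metric and the unit vector fields $u=a^{-1}\partial_t$ and $e=b^{-1}\partial_\chi$. Put $h_{\mu\nu}=g_{\mu\nu}+u_\mu u_\nu$ and $N_{\mu\nu}=h_{\mu\nu}-e_\mu e_\nu$. The 2-sheets are the surfaces of constant $(t,\chi)$; $K$ is their Gaussian curvature, $\phi=N^{\mu\nu}\nabla_\mu e_\nu$ their sheet expansion, and $\Theta_k=N^{\mu\nu}\nabla_\mu k_\nu$, $\Theta_l=N^{\mu\nu}\nabla_\mu l_\nu$ are their null expansions, for $k^\mu=(u^\mu+e^\mu)/\sqrt2$ and $l^\mu=(u^\mu-e^\mu)/\sqrt2$. Write $\hat\psi=e^\mu\partial_\mu\psi$ for scalars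 $\psi$, $\mathcal A=e^\mu u^\nu\nabla_\nu u_\mu$, $\alpha=-(\hat\phi+\tfrac12\phi^2)$ and $\beta=-\big[\tfrac12(\hat\phi+\phi^2)-K\big]$. **Proposition.** Let $\Xi\subset M$ be a nonempty compact embedded hypersurface orthogonal to $u$ (so it is spacelike with induced metric $h_{\mu\nu}$; it may have a boundary made up of 2-sheets), representing a horizon at an instant $T$, and suppose that on $\Xi$ * the 2-sheets foliating $\Xi$ are marginally trapped: $\Theta_k=0$ and $\Theta_l<0$; * $K>0$; * $\hat\phi+\tfrac34\phi^2=0$ (the case $c=0$ of $\hat\phi+\tfrac34\phi^2-cK=0$); * the induced metric is time dependent: $\partial_t h_{\mu\nu}$ is not identically zero on $\Xi$. Then the normalized Ricci flow equation $$u^\delta\nabla_\delta h_{\mu\nu}=-2R_{\mu\nu}+\tfrac23 R\,h_{\mu\nu}$$ does not hold on $\Xi$, where $R_{\mu\nu}$ and $R$ are the Ricci tensor and the Ricci scalar of the induced metric of the hypersurface orthogonal to $u$; and it is impossible that $\mathcal A=0$ and $\alpha=\beta$ everywhere on $\Xi$. In other words, the normalized Ricci flow equation has no solution at a time $T$ at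 which $\mathcal A=0$ and $\alpha=\beta$. -/

import Mathlib

open scoped ContDiff

noncomputable section

namespace LRS

/-! ### Tensor calculus in a coordinate chart of `ℝⁿ` -/

/-- The partial derivative `∂ᵢ f` at `x`. -/
def pd {n : ℕ} (f : (Fin n → ℝ) → ℝ) (i : Fin n) (x : Fin n → ℝ) : ℝ :=
  deriv (fun s : ℝ => f (Function.update x i s)) (x i)

/-- The components of a field of bilinear forms: `g x μ ν`. -/
abbrev BilinField (n : ℕ) := (Fin n → ℝ) → Matrix (Fin n) (Fin n) ℝ

/-- The Christoffel symbol `Γᵏᵢⱼ = ½ gᵏˡ (∂ᵢ gⱼₗ + ∂ⱼ gᵢₗ - ∂ₗ gᵢⱼ)` of the Levi-Civita connection. -/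
def christoffel {n : ℕ} (g : BilinField n) (k i j : Fin n) (x : Fin n → ℝ) : ℝ :=
  (1 / 2) * ∑ l, (g x)⁻¹ k l *
    (pd (fun y => g y j l) i x + pd (fun y => g y i l) j x - pd (fun y => g y i j) l x)

/-- The Ricci tensor
`Rᵢⱼ = ∂ₖ Γᵏᵢⱼ - ∂ⱼ Γᵏᵢₖ + Γᵏₖₗ Γˡᵢⱼ - Γᵏⱼₗ Γˡᵢₖ` of the metric `g`. -/
def ricci {n : ℕ} (g : BilinField n) (i j : Fin n) (x : Fin n → ℝ) : ℝ :=
  ∑ k, (pd (christoffel g k i j) k x - pd (christoffel g k i k) j x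
    + ∑ l, (christoffel g k k l x * christoffel g l i j x
      - christoffel g k j l x * christoffel g l i k x))

/-- The scalar curvature `gⁱʲ Rᵢⱼ` of the metric `g`. -/
def scalarCurvature {n : ℕ} (g : BilinField n) (x : Fin n → ℝ) : ℝ :=
  ∑ i, ∑ j, (g x)⁻¹ i j * ricci g i j x

/-- The covariant derivative `∇_μ w_ν` of a covector field `w`. -/
def nablaCovector {n : ℕ} (g : BilinField n) (w : (Fin n → ℝ) → Fin n → ℝ)
    (μ ν : Fin n) (x : Fin n → ℝ) : ℝ :=
  pd (fun y => w y ν) μ x - ∑ σ, christoffel g σ μ ν x * w x σ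

/-- The covariant derivative `∇_δ S_{μν}` of a field `S` of bilinear forms. -/
def nablaBilin {n : ℕ} (g : BilinField n) (S : BilinField n)
    (δ μ ν : Fin n) (x : Fin n → ℝ) : ℝ :=
  pd (fun y => S y μ ν) δ x
    - ∑ σ, christoffel g σ δ μ x * S x σ ν - ∑ σ, christoffel g σ δ ν x * S x μ σ

/-! ### The line element of an LRS II spacetime in adapted coordinates `(t, χ, y, z)` -/

/-- `G(y, k)`: `sin y`, `y`, `sinh y` for `k = 1, 0, -1`. -/
def sheetProfile (k : ℤ) (y : ℝ) : ℝ :=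
  if k = 1 then Real.sin y else if k = 0 then y else Real.sinh y

/-- The data of the line element
`ds² = -a(t,χ)² dt² + b(t,χ)² dχ² + F(t,χ)² (dy² + G(y,k)² dz²)`. -/
structure LineElement where
  k : ℤ
  a : ℝ → ℝ → ℝ
  b : ℝ → ℝ → ℝ
  F : ℝ → ℝ → ℝ

namespace LineElement

variable (L : LineElement)

/-- The spacetime metric `g_{μν}`. -/
def metric : BilinField 4 := fun x =>
  Matrix.diagonal ![-(L.a (x 0) (x 1)) ^ 2, (L.b (x 0) (x 1)) ^ 2, (L.F (x 0) (x 1)) ^ 2,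
    (L.F (x 0) (x 1)) ^ 2 * (sheetProfile L.k (x 2)) ^ 2]

/-- The unit timelike vector field `u = a⁻¹ ∂_t`. -/
def u (x : Fin 4 → ℝ) : Fin 4 → ℝ := ![(L.a (x 0) (x 1))⁻¹, 0, 0, 0]

/-- The preferred unit spacelike vector field `e = b⁻¹ ∂_χ`. -/
def e (x : Fin 4 → ℝ) : Fin 4 → ℝ := ![0, (L.b (x 0) (x 1))⁻¹, 0, 0]

/-- Lowering an index: `v_μ = g_{μν} v^ν`. -/
def lower (v : (Fin 4 → ℝ) → Fin 4 → ℝ) (x : Fin 4 → ℝ) : Fin 4 → ℝ :=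
  (L.metric x).mulVec (v x)

/-- The tensor `h_{μν} = g_{μν} + u_μ u_ν`, the induced metric of the hypersurfaces orthogonal
to `u`. -/
def h : BilinField 4 := fun x =>
  L.metric x + Matrix.vecMulVec (L.lower L.u x) (L.lower L.u x)

/-- The sheet projector `N_{μν} = g_{μν} + u_μ u_ν - e_μ e_ν`. -/
def N : BilinField 4 := fun x =>
  L.h x - Matrix.vecMulVec (L.lower L.e x) (L.lower L.e x)

/-- `N^{μν}`, with both indices raised by the metric. -/
def Nup (x : Fin 4 → ℝ) : Matrix (Fin 4) (Fin 4) ℝ :=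
  (L.metric x)⁻¹ * L.N x * (L.metric x)⁻¹

/-- The expansion `N^{μν} ∇_μ v_ν` of the sheets in the direction `v`. -/
def sheetDiv (v : (Fin 4 → ℝ) → Fin 4 → ℝ) (x : Fin 4 → ℝ) : ℝ :=
  ∑ μ, ∑ ν, L.Nup x μ ν * nablaCovector L.metric (L.lower v) μ ν x

/-- The sheet expansion `φ = δ_μ e^μ`. -/
def phi (x : Fin 4 → ℝ) : ℝ := L.sheetDiv L.e x

/-- The outgoing null normal `k = (u + e) / √2` of the sheets. -/
def outNull (x : Fin 4 → ℝ) : Fin 4 → ℝ := (√2)⁻¹ • (L.u x + L.e x)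

/-- The ingoing null normal `l = (u - e) / √2` of the sheets, so that `k · l = -1`. -/
def inNull (x : Fin 4 → ℝ) : Fin 4 → ℝ := (√2)⁻¹ • (L.u x - L.e x)

/-- The outgoing null expansion `Θ_k`. -/
def thetaOut (x : Fin 4 → ℝ) : ℝ := L.sheetDiv L.outNull x

/-- The ingoing null expansion `Θ_l`. -/
def thetaIn (x : Fin 4 → ℝ) : ℝ := L.sheetDiv L.inNull x

/-- The acceleration scalar `A = e^μ u^ν ∇_ν u_μ`. -/
def acceleration (x : Fin 4 → ℝ) : ℝ :=
  ∑ μ, ∑ ν, L.e x μ * L.u x ν * nablaCovector L.metric (L.lower L.u) ν μ x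

/-- The hat derivative `e^σ ∂_σ ψ` of a scalar. -/
def hat (ψ : (Fin 4 → ℝ) → ℝ) (x : Fin 4 → ℝ) : ℝ := ∑ σ, L.e x σ * pd ψ σ x

/-- The metric induced on the 2-sheet of constant `(t, χ)`, in the coordinates `(y, z)`. -/
def sheetMetric (t χ : ℝ) : BilinField 2 := fun w =>
  (L.N ![t, χ, w 0, w 1]).submatrix ![2, 3] ![2, 3]

/-- The Gaussian curvature of the 2-sheets: half the scalar curvature of the sheet metric. -/
def gaussK (x : Fin 4 → ℝ) : ℝ :=
  (1 / 2) * scalarCurvature (L.sheetMetric (x 0) (x 1)) ![x 2, x 3]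

/-- The metric induced on the hypersurface of constant `t`, in the coordinates `(χ, y, z)`. -/
def sliceMetric (t : ℝ) : BilinField 3 := fun w =>
  (L.h (Fin.cons t w)).submatrix Fin.succ Fin.succ

/-- The Ricci tensor `R_{μν}` of the hypersurface of constant `t` through `x`, as a spacetime
tensor annihilated by `u`. -/
def sliceRicci (x : Fin 4 → ℝ) (μ ν : Fin 4) : ℝ :=
  Fin.cases 0 (fun i => Fin.cases 0
    (fun j => ricci (L.sliceMetric (x 0)) i j (Fin.tail x)) ν) μ

/-- The Ricci scalar `R` of the hypersurface of constant `t` through `x`. -/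
def sliceScalar (x : Fin 4 → ℝ) : ℝ :=
  scalarCurvature (L.sliceMetric (x 0)) (Fin.tail x)

/-- `α = -(φ̂ + φ²/2)`. -/
def alpha (x : Fin 4 → ℝ) : ℝ := -(L.hat L.phi x + (1 / 2) * L.phi x ^ 2)

/-- `β = -[(φ̂ + φ²)/2 - K]`. -/
def beta (x : Fin 4 → ℝ) : ℝ :=
  -((1 / 2) * (L.hat L.phi x + L.phi x ^ 2) - L.gaussK x)

/-- The covariant time derivative `u^δ ∇_δ h_{μν}`. -/
def dotH (x : Fin 4 → ℝ) (μ ν : Fin 4) : ℝ :=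
  ∑ δ, L.u x δ * nablaBilin L.metric L.h δ μ ν x

/-- The normalized Ricci flow equation
`u^δ ∇_δ h_{μν} = -2 R_{μν} + (2/3) R h_{μν}` at the point `x`. -/
def RicciFlowEqAt (x : Fin 4 → ℝ) : Prop :=
  ∀ μ ν, L.dotH x μ ν = -2 * L.sliceRicci x μ ν + (2 / 3) * L.sliceScalar x * L.h x μ ν

end LineElement

/-! ### LRS II spacetimes and horizons -/

/-- An LRS II spacetime structure on `M`: a smooth atlas of adapted charts `(t, χ, y, z)` in which
the metric is the LRS II line element. The coordinate changes preserve the metric and the two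
vector fields `u` and `e`, so these are globally defined on `M`. -/
structure Spacetime (M : Type*) [TopologicalSpace M] where
  ι : Type
  chart : ι → OpenPartialHomeomorph M (Fin 4 → ℝ)
  line : ι → LineElement
  cover : ∀ p : M, ∃ i, p ∈ (chart i).source
  k : ℤ
  hk : k = -1 ∨ k = 0 ∨ k = 1
  line_k : ∀ i, (line i).k = k
  smooth_a : ∀ i, ContDiffOn ℝ ∞ (fun x : Fin 4 → ℝ => (line i).a (x 0) (x 1)) (chart i).target
  smooth_b : ∀ i, ContDiffOn ℝ ∞ (fun x : Fin 4 → ℝ => (line i).b (x 0) (x 1)) (chart i).target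
  smooth_F : ∀ i, ContDiffOn ℝ ∞ (fun x : Fin 4 → ℝ => (line i).F (x 0) (x 1)) (chart i).target
  a_pos : ∀ i, ∀ x ∈ (chart i).target, 0 < (line i).a (x 0) (x 1)
  b_pos : ∀ i, ∀ x ∈ (chart i).target, 0 < (line i).b (x 0) (x 1)
  F_pos : ∀ i, ∀ x ∈ (chart i).target, 0 < (line i).F (x 0) (x 1)
  G_pos : ∀ i, ∀ x ∈ (chart i).target, 0 < sheetProfile k (x 2)
  smooth_change : ∀ i j, ContDiffOn ℝ ∞ ((chart i).symm.trans (chart j))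
    ((chart i).symm.trans (chart j)).source
  metric_change : ∀ i j, ∀ x ∈ ((chart i).symm.trans (chart j)).source, ∀ v w : Fin 4 → ℝ,
    v ⬝ᵥ ((line i).metric x).mulVec w =
      fderiv ℝ ((chart i).symm.trans (chart j)) x v ⬝ᵥ
        ((line j).metric ((chart i).symm.trans (chart j) x)).mulVec
          (fderiv ℝ ((chart i).symm.trans (chart j)) x w)
  u_change : ∀ i j, ∀ x ∈ ((chart i).symm.trans (chart j)).source,
    fderiv ℝ ((chart i).symm.trans (chart j)) x ((line i).u x) =
      (line j).u ((chart i).symm.trans (chart j) x)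
  e_change : ∀ i j, ∀ x ∈ ((chart i).symm.trans (chart j)).source,
    fderiv ℝ ((chart i).symm.trans (chart j)) x ((line i).e x) =
      (line j).e ((chart i).symm.trans (chart j) x)

namespace Spacetime

variable {M : Type*} [TopologicalSpace M] (S : Spacetime M)

/-- `P` holds, in every adapted chart, at every point of `Ξ`. Used only for conditions that do not
depend on the chart. -/
def Everywhere (Ξ : Set M) (P : LineElement → (Fin 4 → ℝ) → Prop) : Prop :=
  ∀ p ∈ Ξ, ∀ i, p ∈ (S.chart i).source → P (S.line i) (S.chart i p)

/-- `P` holds, in some adapted chart, at some point of `Ξ`. -/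
def Somewhere (Ξ : Set M) (P : LineElement → (Fin 4 → ℝ) → Prop) : Prop :=
  ∃ p ∈ Ξ, ∃ i, p ∈ (S.chart i).source ∧ P (S.line i) (S.chart i p)

/-- `Ξ` is an embedded hypersurface orthogonal to `u` (hence spacelike, with induced metric `h`),
made up of 2-sheets. It may have a boundary, which then consists of 2-sheets: near each of its
points, `Ξ` is `{t = t₀}`, or the part `χ ≥ χ₀` or `χ ≤ χ₀` of it with `χ₀` the value of `χ` at
that point. -/
def IsOrthogonalHypersurface (Ξ : Set M) : Prop :=
  ∀ p ∈ Ξ, ∃ i, ∃ U : Set M, IsOpen U ∧ p ∈ U ∧ U ⊆ (S.chart i).source ∧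
    (Ξ ∩ U = {q ∈ U | S.chart i q 0 = S.chart i p 0} ∨
     Ξ ∩ U = {q ∈ U | S.chart i q 0 = S.chart i p 0 ∧ S.chart i p 1 ≤ S.chart i q 1} ∨
     Ξ ∩ U = {q ∈ U | S.chart i q 0 = S.chart i p 0 ∧ S.chart i q 1 ≤ S.chart i p 1})

/-- `Ξ` is a compact horizon: a nonempty compact spacelike hypersurface orthogonal to `u`, foliated
by 2-sheets that are marginally trapped, i.e. `Θ_k = 0` and `Θ_l < 0`. -/
structure IsCompactHorizon (Ξ : Set M) : Prop where
  nonempty : Ξ.Nonempty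
  compact : IsCompact Ξ
  hypersurface : S.IsOrthogonalHypersurface Ξ
  marginal : S.Everywhere Ξ fun L x => L.thetaOut x = 0 ∧ L.thetaIn x < 0

/-- The induced metric `h` on `Ξ` is time dependent: some `∂_t h_{μν}` is nonzero somewhere. -/
def TimeDependentMetric (Ξ : Set M) : Prop :=
  S.Somewhere Ξ fun L x => ∃ μ ν, pd (fun y => L.h y μ ν) 0 x ≠ 0

/-- The normalized Ricci flow equation is satisfied on `Ξ`. -/
def SatisfiesRicciFlow (Ξ : Set M) : Prop :=
  S.Everywhere Ξ fun L x => L.RicciFlowEqAt x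

end Spacetime

end LRS

end

namespace LRS

open Filter Topology

/-! ### Diagonal metrics -/

/-! Both claims reduce to one: `α = β` cannot hold throughout `Ξ`.

The slices of constant `t` carry the warped metric `b² dχ² + F² (dy² + G² dz²)`, where `G'' = -kG`.
Hence `φ = 2F'/(bF)` and `K = k/F²` (a prime is `∂_χ`), and the slice Ricci tensor satisfies `R_χχ =
α h_χχ` and `R_yy = β h_yy`. As `∇g = 0` and `u` has no spatial covariant components, `u^δ ∇_δ h =
u^δ ∇_δ (u ⊗ u)` has no purely spatial part. The flow equation therefore forces `R_χχ / h_χχ = R/3 =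
R_yy / h_yy`, that is, `α = β` (`alpha_eq_beta_of_ricciFlowEqAt`).

Suppose now that `α = β` on `Ξ`, which contains an open piece of a `χ`-line. There `α = β` reads `φ̂
= -2K`, and with `φ̂ = -¾ φ²` this gives `φ² = (8/3) K`. So `p = F'/b` satisfies `p² = 2k/3`, a
positive constant, and `p' = 0`. Then `φ = 2p/F` yields `φ̂ = -½ φ²`, whence `φ = 0` and `p = 0`, a
contradiction (`not_eventually_alpha_eq_beta`). -/

lemma pd_congr {n : ℕ} {f g : (Fin n → ℝ) → ℝ} {i : Fin n} {x : Fin n → ℝ}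
    (h : ∀ᶠ s in 𝓝 (x i), f (Function.update x i s) = g (Function.update x i s)) :
    pd f i x = pd g i x :=
  Filter.EventuallyEq.deriv_eq h

lemma inv_diagonal_of_ne_zero {n : ℕ} {d : Fin n → ℝ} (hd : ∀ i, d i ≠ 0) :
    (Matrix.diagonal d)⁻¹ = Matrix.diagonal fun i => (d i)⁻¹ := by
  apply Matrix.inv_eq_right_inv
  rw [Matrix.diagonal_mul_diagonal, ← Matrix.diagonal_one]
  congr 1
  funext i
  exact mul_inv_cancel₀ (hd i)

lemma christoffel_diagonal {n : ℕ} (d : (Fin n → ℝ) → Fin n → ℝ) {x : Fin n → ℝ}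
    (hd : ∀ i, d x i ≠ 0) (k i j : Fin n) :
    christoffel (fun y => Matrix.diagonal (d y)) k i j x =
      (1 / 2) * (d x k)⁻¹ * (pd (fun y => Matrix.diagonal (d y) j k) i x
        + pd (fun y => Matrix.diagonal (d y) i k) j x
        - pd (fun y => Matrix.diagonal (d y) i j) k x) := by
  unfold christoffel
  rw [inv_diagonal_of_ne_zero hd, Finset.sum_eq_single k]
  · simp [mul_assoc]
  · intro l _ hl
    simp [Matrix.diagonal_apply_ne _ (Ne.symm hl)]
  · simp

/-! ### Warped metrics `b² dχ² + f² (dy² + G² dz²)` -/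

/-- The metric `b(χ)² dχ² + f(χ)² (dy² + G(y)² dz²)` in the coordinates `(χ, y, z)`. -/
def warpedMetric (b f G : ℝ → ℝ) : BilinField 3 := fun w =>
  Matrix.diagonal ![b (w 0) ^ 2, f (w 0) ^ 2, f (w 0) ^ 2 * G (w 1) ^ 2]

/-- The Christoffel symbols `Γᵏᵢⱼ` of `warpedMetric`. -/
noncomputable def warpedChristoffel (b f G : ℝ → ℝ) (w : Fin 3 → ℝ) : Fin 3 → Fin 3 → Fin 3 → ℝ :=
  ![![![deriv b (w 0) / b (w 0), 0, 0],
      ![0, -(f (w 0) * deriv f (w 0) / b (w 0) ^ 2), 0],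
      ![0, 0, -(f (w 0) * deriv f (w 0) / b (w 0) ^ 2 * G (w 1) ^ 2)]],
    ![![0, deriv f (w 0) / f (w 0), 0],
      ![deriv f (w 0) / f (w 0), 0, 0],
      ![0, 0, -(G (w 1) * deriv G (w 1))]],
    ![![0, 0, deriv f (w 0) / f (w 0)],
      ![0, 0, deriv G (w 1) / G (w 1)],
      ![deriv f (w 0) / f (w 0), deriv G (w 1) / G (w 1), 0]]]

lemma deriv_sq {f : ℝ → ℝ} {s : ℝ} (hf : DifferentiableAt ℝ f s) :
    deriv (fun s => f s ^ 2) s = 2 * f s * deriv f s := by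
  simpa using (hf.hasDerivAt.fun_pow 2).deriv

lemma christoffel_warpedMetric {b f G : ℝ → ℝ} {w : Fin 3 → ℝ}
    (hb : b (w 0) ≠ 0) (hf : f (w 0) ≠ 0) (hG : G (w 1) ≠ 0)
    (db : DifferentiableAt ℝ b (w 0)) (df : DifferentiableAt ℝ f (w 0))
    (dG : DifferentiableAt ℝ G (w 1)) (k i j : Fin 3) :
    christoffel (warpedMetric b f G) k i j w = warpedChristoffel b f G w k i j := by
  unfold warpedMetric
  rw [christoffel_diagonal]
  · fin_cases k <;> fin_cases i <;> fin_cases j <;>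
      simp [pd, warpedChristoffel, db, df, dG] <;> field_simp
  · intro i
    fin_cases i <;> simp [hb, hf, hG]

/-- The Ricci tensor differentiates the Christoffel symbols, so their closed form is needed near `w`
along each coordinate line; nonvanishing and `C²` regularity persist there. -/
lemma pd_christoffel_warpedMetric {b f G : ℝ → ℝ} {w : Fin 3 → ℝ}
    (hb : b (w 0) ≠ 0) (hf : f (w 0) ≠ 0) (hG : G (w 1) ≠ 0)
    (cb : ContDiffAt ℝ 2 b (w 0)) (cf : ContDiffAt ℝ 2 f (w 0))
    (cG : ContDiffAt ℝ 2 G (w 1)) (k i j m : Fin 3) :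
    pd (christoffel (warpedMetric b f G) k i j) m w =
      pd (fun y => warpedChristoffel b f G y k i j) m w := by
  have e : ∀ l, ∀ φ : ℝ → ℝ, φ (w l) ≠ 0 → ContDiffAt ℝ 2 φ (w l) →
      ∀ᶠ s in 𝓝 (w m), φ (Function.update w m s l) ≠ 0 ∧
        DifferentiableAt ℝ φ (Function.update w m s l) := by
    intro l φ h0 hc
    have hl : ∀ᶠ r in 𝓝 (w l), φ r ≠ 0 ∧ DifferentiableAt ℝ φ r := by
      filter_upwards [hc.continuousAt.eventually_ne h0, hc.eventually (by simp)] with r h1 h2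
      exact ⟨h1, h2.differentiableAt (by simp)⟩
    have ht : Tendsto (fun s => Function.update w m s l) (𝓝 (w m)) (𝓝 (w l)) := by
      have : Continuous fun s => Function.update w m s l := by fun_prop
      simpa using this.tendsto (w m)
    exact ht.eventually hl
  apply pd_congr
  filter_upwards [e 0 b hb cb, e 0 f hf cf, e 1 G hG cG] with s h1 h2 h3
  exact christoffel_warpedMetric h1.1 h2.1 h3.1 h1.2 h2.2 h3.2 k i j

/-- The sheet expansion `2 f' / (b f)` of a warped metric. -/
noncomputable def warpedPhi (b f : ℝ → ℝ) (s : ℝ) : ℝ := 2 * deriv f s / (b s * f s)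

lemma differentiableAt_deriv_of_contDiffAt {f : ℝ → ℝ} {s : ℝ} (hf : ContDiffAt ℝ 2 f s) :
    DifferentiableAt ℝ (deriv f) s := by
  have : ContDiffAt ℝ 1 (fun x => fderiv ℝ f x 1) s :=
    (hf.fderiv_right (by norm_num)).clm_apply contDiffAt_const
  exact this.differentiableAt (by simp)

lemma hasDerivAt_warpedPhi {b f : ℝ → ℝ} {s : ℝ} (hb : b s ≠ 0) (hf : f s ≠ 0)
    (cb : ContDiffAt ℝ 2 b s) (cf : ContDiffAt ℝ 2 f s) :
    HasDerivAt (warpedPhi b f)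
      ((2 * deriv (deriv f) s * (b s * f s) -
        2 * deriv f s * (deriv b s * f s + b s * deriv f s)) / (b s * f s) ^ 2) s := by
  have db := (cb.differentiableAt (by simp)).hasDerivAt
  have df := (cf.differentiableAt (by simp)).hasDerivAt
  have ddf := (differentiableAt_deriv_of_contDiffAt cf).hasDerivAt
  exact (ddf.const_mul 2).div (db.mul df) (mul_ne_zero hb hf)

/-- With `φ̂ = φ'/b`, the right side is `b² α`: this is where `α` enters as a Ricci eigenvalue. -/
lemma ricci_warpedMetric_zero_zero {b f G : ℝ → ℝ} {w : Fin 3 → ℝ}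
    (hb : b (w 0) ≠ 0) (hf : f (w 0) ≠ 0) (hG : G (w 1) ≠ 0)
    (cb : ContDiffAt ℝ 2 b (w 0)) (cf : ContDiffAt ℝ 2 f (w 0))
    (cG : ContDiffAt ℝ 2 G (w 1)) :
    ricci (warpedMetric b f G) 0 0 w = -(b (w 0) ^ 2 *
      (deriv (warpedPhi b f) (w 0) / b (w 0) + 1 / 2 * warpedPhi b f (w 0) ^ 2)) := by
  have db := cb.differentiableAt (by simp)
  have df := cf.differentiableAt (by simp)
  have dG := cG.differentiableAt (by simp)
  have ddf := differentiableAt_deriv_of_contDiffAt cf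
  have h1 : deriv (fun s => deriv f s / f s) (w 0) =
      (deriv (deriv f) (w 0) * f (w 0) - deriv f (w 0) * deriv f (w 0)) / f (w 0) ^ 2 :=
    (ddf.hasDerivAt.div df.hasDerivAt hf).deriv
  simp only [ricci, pd_christoffel_warpedMetric hb hf hG cb cf cG,
    christoffel_warpedMetric hb hf hG db df dG, (hasDerivAt_warpedPhi hb hf cb cf).deriv]
  simp [Fin.sum_univ_three, pd, warpedChristoffel, h1, warpedPhi]
  field_simp
  ring

/-- The right side is `f² β` with `K = κ/f²`. The sheet geometry enters only through `G'' = -κ G`,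
which replaces the second derivative of `G`. -/
lemma ricci_warpedMetric_one_one {b f G : ℝ → ℝ} {κ : ℝ} {w : Fin 3 → ℝ}
    (hb : b (w 0) ≠ 0) (hf : f (w 0) ≠ 0) (hG : G (w 1) ≠ 0)
    (cb : ContDiffAt ℝ 2 b (w 0)) (cf : ContDiffAt ℝ 2 f (w 0))
    (cG : ContDiffAt ℝ 2 G (w 1)) (hκ : deriv (deriv G) (w 1) = -κ * G (w 1)) :
    ricci (warpedMetric b f G) 1 1 w = -(f (w 0) ^ 2 *
      (1 / 2 * (deriv (warpedPhi b f) (w 0) / b (w 0) + warpedPhi b f (w 0) ^ 2)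
        - κ / f (w 0) ^ 2)) := by
  have db := cb.differentiableAt (by simp)
  have df := cf.differentiableAt (by simp)
  have dG := cG.differentiableAt (by simp)
  have ddf := differentiableAt_deriv_of_contDiffAt cf
  have ddG := differentiableAt_deriv_of_contDiffAt cG
  have h1 : deriv (fun s => f s * deriv f s / b s ^ 2) (w 0) =
      ((deriv f (w 0) * deriv f (w 0) + f (w 0) * deriv (deriv f) (w 0)) * b (w 0) ^ 2
        - f (w 0) * deriv f (w 0) * (2 * b (w 0) * deriv b (w 0))) / (b (w 0) ^ 2) ^ 2 := by
    have := ((df.hasDerivAt.fun_mul ddf.hasDerivAt).fun_div (db.hasDerivAt.fun_pow 2)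
      (pow_ne_zero 2 hb)).deriv
    simpa using this
  have h2 : deriv (fun s => deriv G s / G s) (w 1) =
      (-κ * G (w 1) * G (w 1) - deriv G (w 1) * deriv G (w 1)) / G (w 1) ^ 2 := by
    rw [← hκ]
    exact (ddG.hasDerivAt.div dG.hasDerivAt hG).deriv
  simp only [ricci, pd_christoffel_warpedMetric hb hf hG cb cf cG,
    christoffel_warpedMetric hb hf hG db df dG, (hasDerivAt_warpedPhi hb hf cb cf).deriv]
  simp [Fin.sum_univ_three, pd, warpedChristoffel, h1, h2, warpedPhi]
  field_simp
  ring

/-! ### The Gaussian curvature of `c² (dy² + G² dz²)` -/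

/-- The metric `c² (dy² + G(y)² dz²)` in the coordinates `(y, z)`. -/
def surfaceMetric (c : ℝ) (G : ℝ → ℝ) : BilinField 2 := fun w =>
  Matrix.diagonal ![c ^ 2, c ^ 2 * G (w 0) ^ 2]

/-- The Christoffel symbols `Γᵏᵢⱼ` of `surfaceMetric`. -/
noncomputable def surfaceChristoffel (G : ℝ → ℝ) (w : Fin 2 → ℝ) : Fin 2 → Fin 2 → Fin 2 → ℝ :=
  ![![![0, 0], ![0, -(G (w 0) * deriv G (w 0))]],
    ![![0, deriv G (w 0) / G (w 0)], ![deriv G (w 0) / G (w 0), 0]]]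

lemma christoffel_surfaceMetric {c : ℝ} {G : ℝ → ℝ} {w : Fin 2 → ℝ}
    (hc : c ≠ 0) (hG : G (w 0) ≠ 0) (dG : DifferentiableAt ℝ G (w 0)) (k i j : Fin 2) :
    christoffel (surfaceMetric c G) k i j w = surfaceChristoffel G w k i j := by
  unfold surfaceMetric
  rw [christoffel_diagonal]
  · fin_cases k <;> fin_cases i <;> fin_cases j <;>
      simp [pd, surfaceChristoffel, dG] <;> field_simp
  · intro i
    fin_cases i <;> simp [hc, hG]

lemma pd_christoffel_surfaceMetric {c : ℝ} {G : ℝ → ℝ} {w : Fin 2 → ℝ}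
    (hc : c ≠ 0) (hG : G (w 0) ≠ 0) (cG : ContDiffAt ℝ 2 G (w 0)) (k i j m : Fin 2) :
    pd (christoffel (surfaceMetric c G) k i j) m w =
      pd (fun y => surfaceChristoffel G y k i j) m w := by
  have hl : ∀ᶠ r in 𝓝 (w 0), G r ≠ 0 ∧ DifferentiableAt ℝ G r := by
    filter_upwards [cG.continuousAt.eventually_ne hG, cG.eventually (by simp)] with r h1 h2
    exact ⟨h1, h2.differentiableAt (by simp)⟩
  have ht : Tendsto (fun s => Function.update w m s 0) (𝓝 (w m)) (𝓝 (w 0)) := by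
    have : Continuous fun s => Function.update w m s 0 := by fun_prop
    simpa using this.tendsto (w m)
  apply pd_congr
  filter_upwards [ht.eventually hl] with s h
  exact christoffel_surfaceMetric hc h.1 h.2 k i j

/-- The surface `dy² + G² dz²` has Gaussian curvature `-G''/G = κ`; scaling by `c²` divides it by
`c²`, and the scalar curvature is twice the Gaussian one. -/
lemma scalarCurvature_surfaceMetric {c κ : ℝ} {G : ℝ → ℝ} {w : Fin 2 → ℝ}
    (hc : c ≠ 0) (hG : G (w 0) ≠ 0) (cG : ContDiffAt ℝ 2 G (w 0))
    (hκ : deriv (deriv G) (w 0) = -κ * G (w 0)) :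
    scalarCurvature (surfaceMetric c G) w = 2 * (κ / c ^ 2) := by
  have dG := cG.differentiableAt (by simp)
  have ddG := differentiableAt_deriv_of_contDiffAt cG
  have h1 : deriv (fun s => G s * deriv G s) (w 0) =
      deriv G (w 0) * deriv G (w 0) + G (w 0) * (-κ * G (w 0)) := by
    rw [← hκ]
    exact (dG.hasDerivAt.mul ddG.hasDerivAt).deriv
  have h2 : deriv (fun s => deriv G s / G s) (w 0) =
      (-κ * G (w 0) * G (w 0) - deriv G (w 0) * deriv G (w 0)) / G (w 0) ^ 2 := by
    rw [← hκ]
    exact (ddG.hasDerivAt.div dG.hasDerivAt hG).deriv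
  have hinv : (surfaceMetric c G w)⁻¹ =
      Matrix.diagonal fun i => ((![c ^ 2, c ^ 2 * G (w 0) ^ 2] : Fin 2 → ℝ) i)⁻¹ := by
    apply inv_diagonal_of_ne_zero
    intro i
    fin_cases i <;> simp [hc, hG]
  simp only [scalarCurvature, hinv, ricci, pd_christoffel_surfaceMetric hc hG cG,
    christoffel_surfaceMetric hc hG dG]
  simp [Fin.sum_univ_two, pd, surfaceChristoffel, h1, h2]
  field_simp
  ring

/-! ### The sheet profile as a solution of `G'' = -kG` -/

lemma contDiff_sheetProfile (k : ℤ) {n : WithTop ℕ∞} : ContDiff ℝ n (sheetProfile k) := by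
  have : sheetProfile k = if k = 1 then Real.sin else if k = 0 then id else Real.sinh := by
    funext y
    unfold sheetProfile
    split_ifs <;> rfl
  rw [this]
  split_ifs
  · exact Real.contDiff_sin
  · exact contDiff_id
  · exact Real.contDiff_sinh

lemma deriv_deriv_sheetProfile {k : ℤ} (hk : k = -1 ∨ k = 0 ∨ k = 1) (y : ℝ) :
    deriv (deriv (sheetProfile k)) y = -(k : ℝ) * sheetProfile k y := by
  rcases hk with rfl | rfl | rfl
  · have : sheetProfile (-1) = Real.sinh := by funext y; simp [sheetProfile]
    simp [this]
  · have : sheetProfile 0 = fun y => y := by funext y; simp [sheetProfile]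
    simp [this]
  · have : sheetProfile 1 = Real.sin := by funext y; simp [sheetProfile]
    simp [this]

/-! ### Geometry of the LRS II line element in a chart -/

namespace LineElement

variable {L : LineElement}

/-- The regularity conditions satisfied by a line element at the points of an adapted chart. -/
structure RegularAt (L : LineElement) (x : Fin 4 → ℝ) : Prop where
  curvature : L.k = -1 ∨ L.k = 0 ∨ L.k = 1
  a_ne : L.a (x 0) (x 1) ≠ 0
  b_ne : L.b (x 0) (x 1) ≠ 0
  F_ne : L.F (x 0) (x 1) ≠ 0
  G_ne : sheetProfile L.k (x 2) ≠ 0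
  b_smooth : ContDiffAt ℝ 2 (L.b (x 0)) (x 1)
  F_smooth : ContDiffAt ℝ 2 (L.F (x 0)) (x 1)

lemma sliceMetric_eq (L : LineElement) (t : ℝ) :
    L.sliceMetric t = warpedMetric (L.b t) (L.F t) (sheetProfile L.k) := by
  funext w
  ext i j
  fin_cases i <;> fin_cases j <;>
    simp [sliceMetric, warpedMetric, h, metric, lower, u, Matrix.mulVec_diagonal,
      Matrix.vecMulVec_apply] <;> first | rfl | exact Or.inl rfl

lemma sheetMetric_eq (L : LineElement) (t χ : ℝ) :
    L.sheetMetric t χ = surfaceMetric (L.F t χ) (sheetProfile L.k) := by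
  funext w
  ext i j
  fin_cases i <;> fin_cases j <;>
    simp [sheetMetric, surfaceMetric, N, h, metric, lower, u, e, Matrix.mulVec_diagonal,
      Matrix.vecMulVec_apply]

lemma contDiffAt_sheetProfile (k : ℤ) (y : ℝ) : ContDiffAt ℝ 2 (sheetProfile k) y :=
  (contDiff_sheetProfile k).contDiffAt

lemma RegularAt.gaussK_eq {x : Fin 4 → ℝ} (r : L.RegularAt x) :
    L.gaussK x = L.k / L.F (x 0) (x 1) ^ 2 := by
  have key := scalarCurvature_surfaceMetric (w := ![x 2, x 3]) r.F_ne (κ := L.k) r.G_ne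
    (contDiffAt_sheetProfile _ _) (deriv_deriv_sheetProfile r.curvature _)
  rw [gaussK, sheetMetric_eq, key]
  ring

lemma RegularAt.metric_ne {x : Fin 4 → ℝ} (r : L.RegularAt x) (i : Fin 4) :
    (![-(L.a (x 0) (x 1)) ^ 2, (L.b (x 0) (x 1)) ^ 2, (L.F (x 0) (x 1)) ^ 2,
      (L.F (x 0) (x 1)) ^ 2 * (sheetProfile L.k (x 2)) ^ 2] : Fin 4 → ℝ) i ≠ 0 := by
  have := r.a_ne
  have := r.b_ne
  have := r.F_ne
  have := r.G_ne
  fin_cases i <;> simp [*]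

lemma RegularAt.christoffel_metric {x : Fin 4 → ℝ} (r : L.RegularAt x) (k i j : Fin 4) :
    christoffel L.metric k i j x =
      (1 / 2) * (![-(L.a (x 0) (x 1)) ^ 2, (L.b (x 0) (x 1)) ^ 2, (L.F (x 0) (x 1)) ^ 2,
        (L.F (x 0) (x 1)) ^ 2 * (sheetProfile L.k (x 2)) ^ 2] k)⁻¹ *
        (pd (fun y => L.metric y j k) i x + pd (fun y => L.metric y i k) j x
          - pd (fun y => L.metric y i j) k x) :=
  christoffel_diagonal _ r.metric_ne k i j

lemma lower_e (L : LineElement) {x : Fin 4 → ℝ} (hb : L.b (x 0) (x 1) ≠ 0) :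
    L.lower L.e x = ![0, L.b (x 0) (x 1), 0, 0] := by
  funext i
  fin_cases i <;> simp [lower, metric, e, Matrix.mulVec_diagonal]
  field_simp

/-- No regularity is assumed, so this is an identity of functions and can be rewritten under `pd`.
-/
lemma h_of_ne_zero (L : LineElement) {μ ν : Fin 4} (hν : ν ≠ 0) (x : Fin 4 → ℝ) :
    L.h x μ ν = L.metric x μ ν := by
  have : L.lower L.u x ν = 0 := by
    fin_cases ν <;> simp_all [lower, metric, u, Matrix.mulVec_diagonal]
  simp [h, Matrix.vecMulVec_apply, this]

lemma RegularAt.h_eq {x : Fin 4 → ℝ} (r : L.RegularAt x) :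
    L.h x = Matrix.diagonal ![0, (L.b (x 0) (x 1)) ^ 2, (L.F (x 0) (x 1)) ^ 2,
      (L.F (x 0) (x 1)) ^ 2 * (sheetProfile L.k (x 2)) ^ 2] := by
  have := r.a_ne
  ext i j
  fin_cases i <;> fin_cases j <;>
    simp [h, metric, lower, u, Matrix.mulVec_diagonal, Matrix.vecMulVec_apply]
  field_simp
  ring

lemma RegularAt.Nup_eq {x : Fin 4 → ℝ} (r : L.RegularAt x) :
    L.Nup x = Matrix.diagonal ![0, 0, ((L.F (x 0) (x 1)) ^ 2)⁻¹,
      ((L.F (x 0) (x 1)) ^ 2 * (sheetProfile L.k (x 2)) ^ 2)⁻¹] := by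
  have hb := r.b_ne
  have hF := r.F_ne
  have hG := r.G_ne
  have hN : L.N x = Matrix.diagonal ![0, 0, (L.F (x 0) (x 1)) ^ 2,
      (L.F (x 0) (x 1)) ^ 2 * (sheetProfile L.k (x 2)) ^ 2] := by
    rw [N, r.h_eq, lower_e L hb]
    ext i j
    fin_cases i <;> fin_cases j <;> simp
    ring
  rw [Nup, hN, metric, inv_diagonal_of_ne_zero r.metric_ne, Matrix.diagonal_mul_diagonal,
    Matrix.diagonal_mul_diagonal]
  congr 1
  funext i
  fin_cases i <;> simp <;> field_simp

/-- Only the `yy` and `zz` terms of the trace survive, each equal to `F'/(bF)` and coming from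
`-Γ^χ_yy e_χ` and `-Γ^χ_zz e_χ`. The condition `hb` makes the formula for `e_μ` available under
`pd`. -/
lemma RegularAt.phi_eq {x : Fin 4 → ℝ} (r : L.RegularAt x)
    (hb : ∀ m, ∀ᶠ s in 𝓝 (x m), L.b (Function.update x m s 0) (Function.update x m s 1) ≠ 0) :
    L.phi x = warpedPhi (L.b (x 0)) (L.F (x 0)) (x 1) := by
  have hb0 := r.b_ne
  have hF := r.F_ne
  have hG := r.G_ne
  have dF := r.F_smooth.differentiableAt (by simp)
  have h0 : ∀ ν m, ν ≠ 1 → pd (fun y => L.lower L.e y ν) m x = 0 := by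
    intro ν m hν
    have : pd (fun y => L.lower L.e y ν) m x = pd (fun _ => 0) m x := by
      apply pd_congr
      filter_upwards [hb m] with s hs
      rw [lower_e L hs]
      fin_cases ν <;> simp_all
    rw [this]
    simp [pd]
  rw [phi, sheetDiv, r.Nup_eq]
  simp only [nablaCovector, r.christoffel_metric, lower_e L hb0, Fin.sum_univ_four,
    h0 2 2 (by decide), h0 3 3 (by decide)]
  simp [metric, pd, deriv_sq dF, warpedPhi]
  field_simp
  ring

/-- Metric compatibility leaves only derivatives of `u_μ u_ν`, each with a factor `u_ν = 0`; the
proof checks this in coordinates. -/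
lemma RegularAt.dotH_eq_zero {x : Fin 4 → ℝ} (r : L.RegularAt x) {ν : Fin 4} (hν : ν ≠ 0) :
    L.dotH x ν ν = 0 := by
  have hh : (fun y => L.h y ν ν) = fun y => L.metric y ν ν := by
    funext y
    exact h_of_ne_zero L hν y
  have hb := r.b_ne
  have hF := r.F_ne
  have hG := r.G_ne
  simp only [dotH, nablaBilin, hh, r.christoffel_metric]
  rw [r.h_eq]
  fin_cases ν
  · simp at hν
  all_goals
    simp [u, metric, Fin.sum_univ_four, Matrix.diagonal_apply, pd, -mul_eq_zero]
    field_simp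
    ring

lemma hat_eq (L : LineElement) (ψ : (Fin 4 → ℝ) → ℝ) (x : Fin 4 → ℝ) :
    L.hat ψ x = pd ψ 1 x / L.b (x 0) (x 1) := by
  simp [hat, e, Fin.sum_univ_four]
  ring

lemma RegularAt.alpha_eq_beta_of_ricciFlowEqAt {x : Fin 4 → ℝ} (r : L.RegularAt x)
    (hφ : ∀ᶠ s in 𝓝 (x 1), L.phi (Function.update x 1 s) =
      warpedPhi (L.b (x 0)) (L.F (x 0)) s) (flow : L.RicciFlowEqAt x) :
    L.alpha x = L.beta x := by
  have hb := r.b_ne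
  have hF := r.F_ne
  have hpd : pd L.phi 1 x = deriv (warpedPhi (L.b (x 0)) (L.F (x 0))) (x 1) :=
    Filter.EventuallyEq.deriv_eq hφ
  have h0 : L.phi x = warpedPhi (L.b (x 0)) (L.F (x 0)) (x 1) := by
    simpa using hφ.self_of_nhds
  -- The `χχ` and `yy` components suffice: subtracting them, once normalized by `h`, eliminates `R`.
  have f1 := flow 1 1
  have f2 := flow 2 2
  rw [r.dotH_eq_zero (by decide), r.h_eq] at f1 f2
  have R1 : L.sliceRicci x 1 1 = ricci (L.sliceMetric (x 0)) 0 0 (Fin.tail x) := rfl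
  have R2 : L.sliceRicci x 2 2 = ricci (L.sliceMetric (x 0)) 1 1 (Fin.tail x) := rfl
  rw [R1, sliceMetric_eq, ricci_warpedMetric_zero_zero (w := Fin.tail x) hb hF r.G_ne
    r.b_smooth r.F_smooth (contDiffAt_sheetProfile _ _)] at f1
  rw [R2, sliceMetric_eq, ricci_warpedMetric_one_one (w := Fin.tail x) hb hF r.G_ne
    r.b_smooth r.F_smooth (contDiffAt_sheetProfile _ _)
    (deriv_deriv_sheetProfile r.curvature _)] at f2
  rw [alpha, beta, hat_eq, hpd, h0, r.gaussK_eq]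
  have t0 : Fin.tail x 0 = x 1 := rfl
  simp only [t0, Matrix.diagonal_apply_eq] at f1 f2
  generalize deriv (warpedPhi (L.b (x 0)) (L.F (x 0))) (x 1) / L.b (x 0) (x 1) = p at *
  generalize warpedPhi (L.b (x 0)) (L.F (x 0)) (x 1) = q at *
  generalize (L.k : ℝ) / L.F (x 0) (x 1) ^ 2 = κ at *
  have g1 : L.b (x 0) (x 1) ^ 2 * (2 * (p + 1 / 2 * q ^ 2) + 2 / 3 * L.sliceScalar x) = 0 := by
    simp at f1
    linear_combination -f1
  have g2 : L.F (x 0) (x 1) ^ 2 * (2 * (1 / 2 * (p + q ^ 2) - κ) + 2 / 3 * L.sliceScalar x)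
      = 0 := by
    simp at f2
    linear_combination -f2
  have g1 := (mul_eq_zero.mp g1).resolve_left (pow_ne_zero 2 hb)
  have g2 := (mul_eq_zero.mp g2).resolve_left (pow_ne_zero 2 hF)
  linarith

end LineElement

/-! ### The contradiction along a `χ`-line -/

/-- A warped profile whose sheet curvature is `K = κ / f² > 0` cannot satisfy both
`φ̂ + ¾ φ² = 0` and `α = β` on an open interval. -/
lemma not_eventually_alpha_eq_beta {b f : ℝ → ℝ} {s₀ κ : ℝ} (hκ : 0 < κ)
    (h : ∀ᶠ s in 𝓝 s₀, b s ≠ 0 ∧ f s ≠ 0 ∧ ContDiffAt ℝ 2 b s ∧ ContDiffAt ℝ 2 f s ∧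
      deriv (warpedPhi b f) s / b s + 3 / 4 * warpedPhi b f s ^ 2 = 0 ∧
      deriv (warpedPhi b f) s / b s + 1 / 2 * warpedPhi b f s ^ 2 =
        1 / 2 * (deriv (warpedPhi b f) s / b s + warpedPhi b f s ^ 2) - κ / f s ^ 2) :
    False := by
  -- Eliminating `φ̂` gives `⅜ φ² = κ/f²`; with `φ = 2p/f` and `p = f'/b`, the factors of `f` cancel
  -- and `p² = ⅔ κ`.
  have hp : ∀ᶠ s in 𝓝 s₀, (deriv f s / b s) ^ 2 = 2 / 3 * κ := by
    filter_upwards [h] with s ⟨hb, hf, _, _, h1, h2⟩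
    have h3 : 3 / 8 * warpedPhi b f s ^ 2 = κ / f s ^ 2 := by linarith
    rw [warpedPhi] at h3
    field_simp at h3 ⊢
    linarith
  obtain ⟨hb, hf, cb, cf, h1, -⟩ := h.self_of_nhds
  have hp0 := hp.self_of_nhds
  have df := (cf.differentiableAt (by simp)).hasDerivAt
  have dp : DifferentiableAt ℝ (fun s => deriv f s / b s) s₀ :=
    (differentiableAt_deriv_of_contDiffAt cf).fun_div (cb.differentiableAt (by simp)) hb
  have hne : deriv f s₀ / b s₀ ≠ 0 := by
    intro h0
    rw [h0] at hp0
    linarith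
  -- Differentiating the constant `p²` gives `2 p p' = 0`, and `p ≠ 0`.
  have hd : deriv (fun s => deriv f s / b s) s₀ = 0 := by
    have e1 := deriv_sq dp
    have e2 : deriv (fun s => (deriv f s / b s) ^ 2) s₀ = 0 := by
      rw [Filter.EventuallyEq.deriv_eq hp]
      simp
    rw [e2] at e1
    simpa [hne] using e1.symm
  -- As `p' = 0`, this says `φ̂ = -2p²/f² = -½ φ²`, which agrees with `-¾ φ²` only if `p = 0`.
  have hφ : deriv (warpedPhi b f) s₀ = -(2 * (deriv f s₀ / b s₀) * deriv f s₀ / f s₀ ^ 2) := by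
    have e1 : warpedPhi b f = fun s => 2 * (deriv f s / b s) / f s := by
      funext s
      rw [warpedPhi, ← mul_div_assoc, div_div]
    rw [e1, ((dp.hasDerivAt.const_mul 2).fun_div df hf).deriv, hd]
    ring
  rw [hφ, warpedPhi] at h1
  apply hne
  have : (deriv f s₀ / b s₀) ^ 2 = 0 := by
    field_simp at h1 ⊢
    linarith
  exact pow_eq_zero_iff (by norm_num) |>.mp this

/-! ### From charts to the hypersurface -/

namespace Spacetime

variable {M : Type*} [TopologicalSpace M] (S : Spacetime M)

lemma regularAt (i : S.ι) {x : Fin 4 → ℝ} (hx : x ∈ (S.chart i).target) :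
    (S.line i).RegularAt x := by
  have ho := (S.chart i).open_target.mem_nhds hx
  have smooth : ∀ f : ℝ → ℝ → ℝ,
      ContDiffOn ℝ ∞ (fun x : Fin 4 → ℝ => f (x 0) (x 1)) (S.chart i).target →
      ContDiffAt ℝ 2 (f (x 0)) (x 1) := by
    intro f hf
    have h1 : ContDiffAt ℝ 2 (fun x : Fin 4 → ℝ => f (x 0) (x 1))
        (Function.update x 1 (x 1)) := by
      rw [Function.update_eq_self]
      exact (hf.contDiffAt ho).of_le (WithTop.coe_le_coe.mpr le_top)
    have h2 : ContDiffAt ℝ 2 (fun s => Function.update x 1 s) (x 1) :=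
      (contDiff_update 2 x 1).contDiffAt
    simpa [Function.comp_def] using h1.comp (x 1) h2
  exact ⟨S.line_k i ▸ S.hk, (S.a_pos i x hx).ne', (S.b_pos i x hx).ne', (S.F_pos i x hx).ne',
    S.line_k i ▸ (S.G_pos i x hx).ne', smooth _ (S.smooth_b i), smooth _ (S.smooth_F i)⟩

lemma phi_eq (i : S.ι) {x : Fin 4 → ℝ} (hx : x ∈ (S.chart i).target) :
    (S.line i).phi x = warpedPhi ((S.line i).b (x 0)) ((S.line i).F (x 0)) (x 1) := by
  apply (S.regularAt i hx).phi_eq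
  intro m
  have hc : Continuous fun s => Function.update x m s := by fun_prop
  have ht : Tendsto (fun s => Function.update x m s) (𝓝 (x m)) (𝓝 x) := by
    simpa using hc.tendsto (x m)
  filter_upwards [ht.eventually ((S.chart i).open_target.mem_nhds hx)] with s hs
  exact (S.b_pos i _ hs).ne'

lemma eventually_phi_eq (i : S.ι) {x : Fin 4 → ℝ} (hx : x ∈ (S.chart i).target) :
    ∀ᶠ s in 𝓝 (x 1), (S.line i).phi (Function.update x 1 s) =
      warpedPhi ((S.line i).b (x 0)) ((S.line i).F (x 0)) s := by
  have hc : Continuous fun s => Function.update x 1 s := by fun_prop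
  have ht : Tendsto (fun s => Function.update x 1 s) (𝓝 (x 1)) (𝓝 x) := by
    simpa using hc.tendsto (x 1)
  filter_upwards [ht.eventually ((S.chart i).open_target.mem_nhds hx)] with s hs
  simpa using S.phi_eq i hs

lemma hat_phi_eq (i : S.ι) {x : Fin 4 → ℝ} (hx : x ∈ (S.chart i).target) :
    (S.line i).hat (S.line i).phi x =
      deriv (warpedPhi ((S.line i).b (x 0)) ((S.line i).F (x 0))) (x 1) /
        (S.line i).b (x 0) (x 1) := by
  rw [LineElement.hat_eq, pd, Filter.EventuallyEq.deriv_eq (S.eventually_phi_eq i hx)]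

/-- A hypersurface orthogonal to `u` contains an open segment of a `χ`-line. -/
lemma IsOrthogonalHypersurface.exists_segment {S : Spacetime M} {Ξ : Set M}
    (hΞ : S.IsOrthogonalHypersurface Ξ) (hne : Ξ.Nonempty) :
    ∃ i, ∃ x : Fin 4 → ℝ, ∀ᶠ s in 𝓝 (x 1), Function.update x 1 s ∈ (S.chart i).target ∧
      (S.chart i).symm (Function.update x 1 s) ∈ Ξ := by
  obtain ⟨p, hp⟩ := hne
  obtain ⟨i, U, hU, hpU, hUs, hcase⟩ := hΞ p hp
  set x := S.chart i p with hx
  have hxt : x ∈ (S.chart i).target := (S.chart i).map_source (hUs hpU)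
  have hc : Continuous fun s => Function.update x 1 s := by fun_prop
  have ht : Tendsto (fun s => Function.update x 1 s) (𝓝 (x 1)) (𝓝 x) := by
    simpa using hc.tendsto (x 1)
  have hsymm : (S.chart i).symm x = p := (S.chart i).left_inv (hUs hpU)
  have hpre : ∀ᶠ y in 𝓝 x, y ∈ (S.chart i).target ∧ (S.chart i).symm y ∈ U := by
    refine Filter.Eventually.and ((S.chart i).open_target.mem_nhds hxt)
      (((S.chart i).continuousAt_symm hxt).eventually (hU.mem_nhds ?_))
    rwa [hsymm]
  obtain ⟨ε, hε, hball⟩ := Metric.eventually_nhds_iff.mp (ht.eventually hpre)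
  -- The centre `s₁` of the segment is left free because the given point may lie on a boundary sheet
  -- of `Ξ`.
  have main : ∀ s₁ : ℝ, (∀ᶠ s in 𝓝 s₁, dist s (x 1) < ε ∧
      ∀ q ∈ U, S.chart i q = Function.update x 1 s → q ∈ Ξ) →
      ∃ i, ∃ x : Fin 4 → ℝ, ∀ᶠ s in 𝓝 (x 1), Function.update x 1 s ∈ (S.chart i).target ∧
        (S.chart i).symm (Function.update x 1 s) ∈ Ξ := by
    intro s₁ hs₁
    refine ⟨i, Function.update x 1 s₁, ?_⟩
    simp only [Function.update_self, Function.update_idem]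
    filter_upwards [hs₁] with s hs
    have hb := hball hs.1
    exact ⟨hb.1, hs.2 _ hb.2 ((S.chart i).right_inv hb.1)⟩
  rcases hcase with hcase | hcase | hcase
  · apply main (x 1)
    filter_upwards [Metric.ball_mem_nhds (x 1) hε] with s hs
    refine ⟨hs, fun q hq hqs => ?_⟩
    have : q ∈ Ξ ∩ U := by
      rw [hcase]
      exact ⟨hq, by simp [hqs]⟩
    exact this.1
  -- At a boundary sheet the centre moves `ε / 2` into `Ξ`, so that a two-sided neighbourhood fits.
  · apply main (x 1 + ε / 2)
    filter_upwards [Ioo_mem_nhds (show x 1 < x 1 + ε / 2 by linarith)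
      (show x 1 + ε / 2 < x 1 + ε by linarith)] with s hs
    refine ⟨by rw [Real.dist_eq, abs_lt]; constructor <;> linarith [hs.1, hs.2],
      fun q hq hqs => ?_⟩
    have : q ∈ Ξ ∩ U := by
      rw [hcase]
      exact ⟨hq, by simp [hqs], by simpa [hqs] using hs.1.le⟩
    exact this.1
  · apply main (x 1 - ε / 2)
    filter_upwards [Ioo_mem_nhds (show x 1 - ε < x 1 - ε / 2 by linarith)
      (show x 1 - ε / 2 < x 1 by linarith)] with s hs
    refine ⟨by rw [Real.dist_eq, abs_lt]; constructor <;> linarith [hs.1, hs.2],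
      fun q hq hqs => ?_⟩
    have : q ∈ Ξ ∩ U := by
      rw [hcase]
      exact ⟨hq, by simp [hqs], by simpa [hqs] using hs.2.le⟩
    exact this.1

/-- On a hypersurface orthogonal to `u` with `K > 0` and `φ̂ + ¾ φ² = 0`, the equality `α = β`
fails somewhere. -/
lemma not_everywhere_alpha_eq_beta {S : Spacetime M} {Ξ : Set M}
    (hΞ : S.IsOrthogonalHypersurface Ξ) (hne : Ξ.Nonempty)
    (K_pos : S.Everywhere Ξ fun L x => 0 < L.gaussK x)
    (hat_phi : S.Everywhere Ξ fun L x => L.hat L.phi x + (3 / 4) * L.phi x ^ 2 = 0) :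
    ¬ S.Everywhere Ξ fun L x => L.alpha x = L.beta x := by
  intro hαβ
  obtain ⟨i, x, hseg⟩ := hΞ.exists_segment hne
  have transfer : ∀ {P : LineElement → (Fin 4 → ℝ) → Prop}, S.Everywhere Ξ P →
      ∀ {y}, y ∈ (S.chart i).target → (S.chart i).symm y ∈ Ξ → P (S.line i) y := by
    intro P hP y hy hyΞ
    simpa [(S.chart i).right_inv hy] using hP _ hyΞ i ((S.chart i).map_target hy)
  -- Since `K = k/F²`, positivity of `K` at one point fixes the sign of `k`.
  have hκ : 0 < ((S.line i).k : ℝ) := by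
    have h0 := hseg.self_of_nhds
    rw [Function.update_eq_self] at h0
    have hK := transfer K_pos h0.1 h0.2
    rw [(S.regularAt i h0.1).gaussK_eq] at hK
    exact (div_pos_iff_of_pos_right (pow_pos (S.F_pos i x h0.1) 2)).mp hK
  apply not_eventually_alpha_eq_beta (b := (S.line i).b (x 0)) (f := (S.line i).F (x 0))
    (s₀ := x 1) hκ
  filter_upwards [hseg] with s ⟨hs, hsΞ⟩
  have r := S.regularAt i hs
  have e1 := transfer hat_phi hs hsΞ
  have e2 := transfer hαβ hs hsΞ
  rw [LineElement.alpha, LineElement.beta, S.hat_phi_eq i hs, S.phi_eq i hs, r.gaussK_eq] at e2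
  rw [S.hat_phi_eq i hs, S.phi_eq i hs] at e1
  have e2 := neg_injective e2
  exact ⟨by simpa using r.b_ne, by simpa using r.F_ne, by simpa using r.b_smooth,
    by simpa using r.F_smooth, by simpa using e1, by simpa using e2⟩

end Spacetime

end LRS

theorem mainTheorem3 {M : Type*} [TopologicalSpace M] [T2Space M] [SecondCountableTopology M]
    (S : LRS.Spacetime M) (Ξ : Set M)
    (horizon : S.IsCompactHorizon Ξ)
    (K_pos : S.Everywhere Ξ fun L x => 0 < L.gaussK x)
    (compactness_eq : S.Everywhere Ξ fun L x =>
      L.hat L.phi x + (3 / 4) * L.phi x ^ 2 = 0)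
    (time_dep : S.TimeDependentMetric Ξ) :
    ¬ S.SatisfiesRicciFlow Ξ ∧
      ¬ S.Everywhere Ξ (fun L x => L.acceleration x = 0 ∧ L.alpha x = L.beta x) := by
  have key := LRS.Spacetime.not_everywhere_alpha_eq_beta horizon.hypersurface horizon.nonempty
    K_pos compactness_eq
  constructor
  · intro flow
    apply key
    intro p hp i hi
    have hx := (S.chart i).map_source hi
    exact (S.regularAt i hx).alpha_eq_beta_of_ricciFlowEqAt (S.eventually_phi_eq i hx)
      (flow p hp i hi)
  · intro hA
    exact key fun p hp i hi => (hA p hp i hi).2
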